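/- **Setting.** Let $\mathbb F_q$ be a finite field with $q=p^k$ elements, $p$ prime, with a basis over its prime field $\mathbb F_p$. An element of $\mathbb F_q$ is encoded by $k\lceil\log_2 p\rceil$ Boolean variables: the binary digits of its $k$ coordinates in the basis, each coordinate being an integer in $\{0,\dots,p-1\}$ (for a prime field with basis $1$, this is the usual binary encoding). The *CNF encoding* $F$ of a system of $m$ linear equations $\sum_j a_{ij}z_j=b_i$ ($1\le i\le m$) over $\mathbb F_q$ is the set consisting of * for each equation and each $\mathbb F_q$-assignment to the variables occurring in it (with non-zero coefficient) that falsifies it, the clause over the Boolean variables encoding these variables that rules out exactly the encoding of this assignment; * for each variable $z_j$ occurring in some equation and each of its coordinates, the clauses ruling out the bit patterns that represent the integers $p,\dots,2^{\lceil\log_2p\rceil}-1$ (none if $p=2$). Let $|F|$ be the number of clauses of $F$. A CNF formula is translated into linear inequalities by taking $0\le x\le 1$ for every variable $x$ and $\sum_{i\in P}x_i+\sum_{i\in N}(1-x_i)\ge 1$ for every clause $\bigvee_{i\in P}x_i\vee\bigvee_{i\in N}\neg x_i$. A *Cutting Planes (CP) refutation* of it is a sequence of integer linear inequalities ending in $0\ge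 1$, each of which is one of these inequalities or follows from earlier ones by a linear combination of two inequalities with non-negative integer multipliers, or by the division rule: from $ax\ge b$ deduce $(a/t)x\ge\lceil b/t\rceil$, where $t\ge1$ is an integer dividing all entries of $a$. Its *size* is the number of its lines. **Theorem.** There is an absolute constant $C$ such that for every finite field $\mathbb F_q$, every basis of $\mathbb F_q$ over its prime field, and every unsatisfiable system of $m$ linear equations over $\mathbb F_q$ with CNF encoding $F$, there is a CP refutation of $F$ of size at most $|F|^{C\log_2 m}$. Moreover, the size of this refutation is also at most $(m\,q^{d-1})^{C\log_2 m}$ for every $d\ge 2$ such that every equation of the system contains at most $d$ variables. -/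

import Mathlib

/-! ### Cutting Planes -/

/-- The integer linear inequality `∑ v, coeff v * x v ≥ rhs` in the variables `x v`, `v : V`. -/
@[ext] structure LinIneq (V : Type*) where
  coeff : V → ℤ
  rhs : ℤ

/-- `l` is an inequality of the system `P`, or it follows from inequalities in `prev` by one
application of the linear combination rule (with non-negative integer multipliers) or of the
division rule (by a positive integer that divides all coefficients). -/
def CPStep {V : Type*} (P prev : Set (LinIneq V)) (l : LinIneq V) : Prop :=
  l ∈ P ∨
  (∃ l₁ ∈ prev, ∃ l₂ ∈ prev, ∃ r t : ℕ,
    (∀ v, l.coeff v = r * l₁.coeff v + t * l₂.coeff v) ∧ l.rhs = r * l₁.rhs + t * l₂.rhs) ∨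
  (∃ l₁ ∈ prev, ∃ d : ℕ, 0 < d ∧
    (∀ v, l₁.coeff v = d * l.coeff v) ∧ l.rhs = ⌈(l₁.rhs : ℚ) / (d : ℚ)⌉)

/-- The sequence `π` of `s` lines is a Cutting Planes proof from the system `P`: every line comes
from `P` and from strictly earlier lines by one step. The size of the proof is `s`. -/
def IsCPProof {V : Type*} (P : Set (LinIneq V)) {s : ℕ} (π : Fin s → LinIneq V) : Prop :=
  ∀ i, CPStep P {l | ∃ j < i, π j = l} (π i)

/-- A Cutting Planes refutation: a proof whose last line is `0 ≥ 1`. -/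
def IsCPRefutation {V : Type*} (P : Set (LinIneq V)) {s : ℕ} (π : Fin s → LinIneq V) : Prop :=
  IsCPProof P π ∧ ∃ i : Fin s, (i : ℕ) + 1 = s ∧ π i = ⟨fun _ => 0, 1⟩

/-! ### CNF formulas and their translation to linear inequalities -/

/-- A clause is a finite set of literals; `(v, true)` is the literal `x v`, and `(v, false)` is the
literal `¬ x v`. -/
abbrev Clause (V : Type*) := Finset (V × Bool)

/-- A CNF formula is a finite set of clauses; its size is the number `F.card` of its clauses. -/
abbrev CNF (V : Type*) := Finset (Clause V)

/-- The inequality `∑ x v + ∑ (1 - x v) ≥ 1` of a clause, the sums being over its positive and over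
its negative literals, with the constants collected on the right. -/
def Clause.toIneq {V : Type*} [DecidableEq V] (C : Clause V) : LinIneq V where
  coeff v := (if (v, true) ∈ C then 1 else 0) - (if (v, false) ∈ C then 1 else 0)
  rhs := 1 - ((C.filter fun ℓ => ℓ.2 = false).card : ℤ)

/-- The system of a CNF formula: `x v ≥ 0` and `-x v ≥ -1` for all variables, and the inequalities
of the clauses. -/
def CNF.system {V : Type*} [DecidableEq V] (F : CNF V) : Set (LinIneq V) :=
  {l | (∃ v, l = ⟨Pi.single v 1, 0⟩) ∨ (∃ v, l = ⟨Pi.single v (-1), -1⟩) ∨ ∃ C ∈ F, l = C.toIneq}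

/-- The clause over the variables in `S` that rules out exactly the assignments agreeing with `τ`
on `S`. -/
def ruleOut {V : Type*} [DecidableEq V] (S : Finset V) (τ : V → Bool) : Clause V :=
  S.image fun v => (v, !τ v)

/-! ### The CNF encoding of a system of linear equations over a finite field

An element of a finite field `K` of characteristic `p` is given by its `k` coordinates in a basis of
`K` over the prime field, and each coordinate, an integer in `{0, …, p - 1}`, by its `⌈log₂ p⌉`
binary digits. (For a prime field, `k = 1` and the basis `1`, this is the usual binary encoding.) -/

/-- The Boolean variables encoding `n` field elements: `(j, κ, l)` is the `l`-th binary digit of the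
`κ`-th coordinate of the `j`-th element. -/
abbrev BitVar (p k n : ℕ) := Fin n × Fin k × Fin (Nat.clog 2 p)

section Encoding

variable {K : Type*} [Field K] [Fintype K] [DecidableEq K] {p : ℕ} [Fact p.Prime]
  [Algebra (ZMod p) K] {k m n : ℕ}

/-- The Boolean assignment encoding the vector `z` of field elements. -/
noncomputable def bits (β : Module.Basis (Fin k) (ZMod p) K) (z : Fin n → K) :
    BitVar p k n → Bool :=
  fun v => (β.repr (z v.1) v.2.1).val.testBit v.2.2

/-- The variables occurring in `∑ j, a j * z j = c`; their number is the width of the equation. -/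
def occurring (a : Fin n → K) : Finset (Fin n) :=
  Finset.univ.filter fun j => a j ≠ 0

/-- The clauses of the equation `∑ j, a j * z j = c`: one for each falsifying assignment of field
elements to the variables that occur in the equation. -/
noncomputable def equationClauses (β : Module.Basis (Fin k) (ZMod p) K) (a : Fin n → K) (c : K) :
    CNF (BitVar p k n) :=
  (Finset.univ.filter fun z : Fin n → K => ∑ j, a j * z j ≠ c).image fun z =>
    ruleOut (occurring a ×ˢ Finset.univ) (bits β z)

/-- The clauses saying that the bits of the variable `j` encode a field element: for each
coordinate, the binary expansions of the numbers `p, …, 2 ^ ⌈log₂ p⌉ - 1` are ruled out. There are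
none for `p = 2`. -/
def rangeClauses (p k : ℕ) {n : ℕ} (j : Fin n) : CNF (BitVar p k n) :=
  Finset.univ.biUnion fun κ : Fin k => (Finset.Ico p (2 ^ Nat.clog 2 p)).image fun t =>
    ruleOut ({j} ×ˢ ({κ} ×ˢ Finset.univ)) fun v => t.testBit v.2.2

/-- The CNF encoding of the system `∑ j, A i j * z j = b i`, `i : Fin m`: the clauses of all the
equations, and the range clauses of all the variables that occur in some equation. -/
noncomputable def linearSystemCNF (β : Module.Basis (Fin k) (ZMod p) K)
    (A : Matrix (Fin m) (Fin n) K) (b : Fin m → K) : CNF (BitVar p k n) :=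
  (Finset.univ.biUnion fun i => equationClauses β (A i) (b i)) ∪
    (Finset.univ.biUnion fun i => occurring (A i)).biUnion fun j => rangeClauses p k j

end Encoding

/-! Pass to a minimal unsatisfiable subsystem, with `M` equations of width at most `W`. By duality,
some combination with coefficients `c i` is the equation `0 = e` with `e ≠ 0`. Multiplying equation
`i` by `c i` and taking a basis coordinate in which `e` is non-zero gives congruences modulo `p` in
the bits, with left-hand sides summing to `0` and right-hand sides not.
`exists_int_lift_sum_eq_zero` lifts the coefficients to integers of absolute value at most `p` so
that the integer forms `α i` sum to the zero form exactly. So the form `∑ α i` has value `0`, while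
the equations force another residue.

This contradiction is found by binary search (`Derivable.refute_sum`): given a wrong value for a sum
of forms, branch on the value of a part of the sum. In every branch the part or its complement has a
wrong value. The depth is about `log₂ M`, and the branching is polynomial because the forms have
small coefficients. At a leaf a single equation has a wrong value, and all assignments to its bits
are refuted by brute force (`Derivable.refute_equation`); their number is polynomial in `q ^ W`.

Cutting Planes has no branching rule. It is simulated by `Derivable.improve`: a refutation of the
face `a x = b` lifts to a derivation of `a x ≥ b + 1` from `a x ≥ b` at the cost of a constant
factor, so the lower bound climbs through the whole range of `a x`.

For the size, minimality gives `M ≤ |F|`, and an equation with a variable is falsified by at least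
half of the assignments to its variables, so `q ^ W ≤ 2 |F|`. -/

/-! ### Derivations in Cutting Planes, with a bound on the number of lines -/

section Derivations

variable {V : Type*}

/-- The list `L`, read from its end, is a Cutting Planes derivation from `P`. -/
inductive IsDerivation (P : Set (LinIneq V)) : List (LinIneq V) → Prop
  | nil : IsDerivation P []
  | cons {l : LinIneq V} {L : List (LinIneq V)} :
      IsDerivation P L → CPStep P {l' | l' ∈ L} l → IsDerivation P (l :: L)

/-- The inequality `l` is derivable from `P` in at most `n` lines. -/
def Derivable (P : Set (LinIneq V)) (n : ℕ) (l : LinIneq V) : Prop :=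
  ∃ L, IsDerivation P L ∧ l ∈ L ∧ L.length ≤ n

theorem CPStep.mono {P P' Q Q' : Set (LinIneq V)} (hP : P ⊆ P') (hQ : Q ⊆ Q') {l : LinIneq V}
    (h : CPStep P Q l) : CPStep P' Q' l := by
  rcases h with h | ⟨l₁, h₁, l₂, h₂, h⟩ | ⟨l₁, h₁, h⟩
  · exact Or.inl (hP h)
  · exact Or.inr (Or.inl ⟨l₁, hQ h₁, l₂, hQ h₂, h⟩)
  · exact Or.inr (Or.inr ⟨l₁, hQ h₁, h⟩)

theorem CPStep.comb {P Q : Set (LinIneq V)} {l₁ l₂ l : LinIneq V} (h₁ : l₁ ∈ Q) (h₂ : l₂ ∈ Q)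
    (r t : ℕ) (hc : ∀ v, l.coeff v = r * l₁.coeff v + t * l₂.coeff v)
    (hr : l.rhs = r * l₁.rhs + t * l₂.rhs) : CPStep P Q l :=
  Or.inr (Or.inl ⟨l₁, h₁, l₂, h₂, r, t, hc, hr⟩)

theorem CPStep.of_mem {P Q : Set (LinIneq V)} {l : LinIneq V} (h : l ∈ Q) : CPStep P Q l :=
  CPStep.comb h h 1 0 (by simp) (by simp)

theorem IsDerivation.mono {P P' : Set (LinIneq V)} (hP : P ⊆ P') {L : List (LinIneq V)}
    (h : IsDerivation P L) : IsDerivation P' L := by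
  induction h with
  | nil => exact .nil
  | cons _ hs ih => exact .cons ih (hs.mono hP subset_rfl)

/-- Premises of a derivation may be replaced by their own derivation. -/
theorem IsDerivation.append {P P' : Set (LinIneq V)} {L L' : List (LinIneq V)}
    (h : IsDerivation P L) (h' : IsDerivation P' L') (hP : ∀ l ∈ P', l ∈ P ∨ l ∈ L) :
    IsDerivation P (L' ++ L) := by
  induction h' with
  | nil => exact h
  | @cons l L' _ hs ih =>
    refine .cons ih ?_
    have hsub : {x | x ∈ L'} ⊆ {x | x ∈ L' ++ L} := fun x hx => List.mem_append_left _ hx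
    rcases hs with hs | hs
    · rcases hP l hs with h | h
      · exact Or.inl h
      · exact .of_mem (List.mem_append_right L' h)
    · exact CPStep.mono (P := ∅) (Set.empty_subset _) hsub (Or.inr hs)

namespace Derivable

theorem mono {P P' : Set (LinIneq V)} {n n' : ℕ} {l : LinIneq V} (h : Derivable P n l)
    (hP : P ⊆ P') (hn : n ≤ n') : Derivable P' n' l := by
  obtain ⟨L, hL, hl, hlen⟩ := h
  exact ⟨L, hL.mono hP, hl, hlen.trans hn⟩

theorem of_mem {P : Set (LinIneq V)} {l : LinIneq V} (h : l ∈ P) : Derivable P 1 l :=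
  ⟨[l], .cons .nil (Or.inl h), by simp, by simp⟩

theorem cut {P : Set (LinIneq V)} {n₁ n₂ : ℕ} {l₁ l₂ : LinIneq V} (h₁ : Derivable P n₁ l₁)
    (h₂ : Derivable (insert l₁ P) n₂ l₂) : Derivable P (n₁ + n₂) l₂ := by
  obtain ⟨L₁, hL₁, hl₁, hn₁⟩ := h₁
  obtain ⟨L₂, hL₂, hl₂, hn₂⟩ := h₂
  refine ⟨L₂ ++ L₁, hL₁.append hL₂ ?_, List.mem_append_left _ hl₂, by simp; omega⟩
  rintro l (rfl | h)
  · exact Or.inr hl₁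
  · exact Or.inl h

theorem comb {P : Set (LinIneq V)} {n₁ n₂ : ℕ} {l₁ l₂ l : LinIneq V} (h₁ : Derivable P n₁ l₁)
    (h₂ : Derivable P n₂ l₂) (r t : ℕ)
    (hc : ∀ v, l.coeff v = r * l₁.coeff v + t * l₂.coeff v)
    (hr : l.rhs = r * l₁.rhs + t * l₂.rhs) : Derivable P (n₁ + n₂ + 1) l := by
  obtain ⟨L₁, hL₁, hl₁, hn₁⟩ := h₁
  obtain ⟨L₂, hL₂, hl₂, hn₂⟩ := h₂
  refine ⟨l :: (L₂ ++ L₁), .cons (hL₁.append hL₂ fun _ => Or.inl) ?_, by simp, by simp; omega⟩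
  exact .comb (List.mem_append_right _ hl₁) (List.mem_append_left _ hl₂) r t hc hr

theorem div {P : Set (LinIneq V)} {n : ℕ} {l₁ l : LinIneq V} (h₁ : Derivable P n l₁) {d : ℕ}
    (hd : 0 < d) (hc : ∀ v, l₁.coeff v = d * l.coeff v)
    (hr : l.rhs = ⌈(l₁.rhs : ℚ) / (d : ℚ)⌉) : Derivable P (n + 1) l := by
  obtain ⟨L₁, hL₁, hl₁, hn₁⟩ := h₁
  exact ⟨l :: L₁, .cons hL₁ (Or.inr (Or.inr ⟨l₁, hl₁, d, hd, hc, hr⟩)), by simp, by simp; omega⟩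

/-- The combination rule needs premises even for zero multipliers, hence the non-emptiness of `P`
here and in all sums below. -/
theorem zero {P : Set (LinIneq V)} (hP : P.Nonempty) : Derivable P 2 ⟨fun _ => 0, 0⟩ := by
  obtain ⟨l, hl⟩ := hP
  exact ⟨[⟨fun _ => 0, 0⟩, l], .cons (.cons .nil (Or.inl hl)) (.comb (l₁ := l) (l₂ := l) (by simp) (by simp)
    0 0 (by simp) (by simp)), by simp, by simp⟩

theorem sum {P : Set (LinIneq V)} (hP : P.Nonempty) {ι : Type*} (T : Finset ι) (f : ι → V → ℤ)
    (b : ι → ℤ) (r : ι → ℕ) {n : ℕ} (h : ∀ i ∈ T, Derivable P n ⟨f i, b i⟩) :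
    Derivable P (2 + T.card * (n + 1)) ⟨fun v => ∑ i ∈ T, r i * f i v, ∑ i ∈ T, r i * b i⟩ := by
  classical
  induction T using Finset.induction_on with
  | empty => simpa using zero hP
  | insert i T hi ih =>
    have h₁ := ih fun j hj => h j (Finset.mem_insert_of_mem hj)
    have h₂ := h i (Finset.mem_insert_self i T)
    refine (comb h₁ h₂ 1 (r i) ?_ ?_).mono subset_rfl ?_
    · intro v
      simp [Finset.sum_insert hi, add_comm]
    · simp [Finset.sum_insert hi, add_comm]
    · rw [Finset.card_insert_of_notMem hi]
      ring_nf
      omega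

end Derivable

/-- A derivation on the face `a x = b` of the polytope lifts to the polytope, where `a x ≥ b` holds:
each line is only changed by a multiple of `a x - b`. -/
theorem IsDerivation.lift {P : Set (LinIneq V)} {a : V → ℤ} {b : ℤ} {L : List (LinIneq V)}
    (h : IsDerivation (insert ⟨-a, -b⟩ P) L) :
    ∃ L', IsDerivation (insert ⟨a, b⟩ P) L' ∧ ⟨a, b⟩ ∈ L' ∧ L'.length ≤ 2 * L.length + 1 ∧
      ∀ l ∈ L, ∃ M : ℕ, (⟨fun v => l.coeff v + M * a v, l.rhs + M * b⟩ : LinIneq V) ∈ L' := by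
  induction h with
  | nil => exact ⟨[⟨a, b⟩], .cons .nil (Or.inl (Or.inl rfl)), by simp, by simp, by simp⟩
  | @cons l L _ hs ih =>
    obtain ⟨L', hL', hab, hlen, hM⟩ := ih
    have single : ∀ M : ℕ, CPStep (insert ⟨a, b⟩ P) {l' | l' ∈ L'}
        ⟨fun v => l.coeff v + M * a v, l.rhs + M * b⟩ → ∃ L'', IsDerivation (insert ⟨a, b⟩ P) L'' ∧
        ⟨a, b⟩ ∈ L'' ∧ L''.length ≤ 2 * (l :: L).length + 1 ∧ ∀ l' ∈ l :: L, ∃ M : ℕ,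
          (⟨fun v => l'.coeff v + M * a v, l'.rhs + M * b⟩ : LinIneq V) ∈ L'' := by
      intro M hs
      refine ⟨_, .cons hL' hs, List.mem_cons_of_mem _ hab, by simp; omega, ?_⟩
      intro l' hl'
      rcases List.mem_cons.1 hl' with rfl | hl'
      · exact ⟨M, List.mem_cons_self⟩
      · obtain ⟨M', hM'⟩ := hM l' hl'
        exact ⟨M', List.mem_cons_of_mem _ hM'⟩
    rcases hs with hs | ⟨l₁, h₁, l₂, h₂, r, t, hc, hr⟩ | ⟨l₁, h₁, d, hd, hc, hr⟩
    · rcases hs with rfl | hs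
      -- The lost premise `-a x ≥ -b` becomes the trivial `0 ≥ 0` once `a x ≥ b` is added to it.
      · exact single 1 (.comb hab hab 0 0 (by simp) (by simp))
      · exact single 0 (Or.inl (Or.inr (by simpa using hs)))
    · obtain ⟨M₁, hM₁⟩ := hM l₁ h₁
      obtain ⟨M₂, hM₂⟩ := hM l₂ h₂
      refine single (r * M₁ + t * M₂) (.comb hM₁ hM₂ r t ?_ ?_)
      · intro v
        simp only [hc]
        push_cast
        ring
      · simp only [hr]
        push_cast
        ring
    · obtain ⟨M₁, hM₁⟩ := hM l₁ h₁
      -- Before dividing by `d`, the multiple `M₁` of `a x - b` is raised to `d * M₁` by adding `a x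
      -- ≥ b` another `(d - 1) * M₁` times. The integer `M₁ * b` then passes through the rounding.
      -- This extra line causes the factor 2 in the length.
      obtain ⟨e, rfl⟩ : ∃ e, d = e + 1 := ⟨d - 1, by omega⟩
      have hs₁ : CPStep (insert ⟨a, b⟩ P) {l' | l' ∈ L'}
          ⟨fun v => l₁.coeff v + ((e + 1) * M₁ : ℕ) * a v, l₁.rhs + ((e + 1) * M₁ : ℕ) * b⟩ := by
        refine .comb hM₁ hab 1 (e * M₁) ?_ ?_
        · intro v
          push_cast
          ring
        · push_cast
          ring
      refine ⟨⟨fun v => l.coeff v + M₁ * a v, l.rhs + M₁ * b⟩ :: _, .cons (.cons hL' hs₁)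
        (Or.inr (Or.inr ⟨_, List.mem_cons_self, e + 1, hd, ?_, ?_⟩)),
        List.mem_cons_of_mem _ (List.mem_cons_of_mem _ hab), by simp; omega, ?_⟩
      · intro v
        simp only [hc]
        push_cast
        ring
      · simp only [hr]
        rw [← Int.ceil_add_intCast]
        congr 1
        push_cast
        field_simp
      · intro l' hl'
        rcases List.mem_cons.1 hl' with rfl | hl'
        · exact ⟨M₁, List.mem_cons_self⟩
        · obtain ⟨M', hM'⟩ := hM l' hl'
          exact ⟨M', List.mem_cons_of_mem _ (List.mem_cons_of_mem _ hM')⟩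

/-- The only gain from rounding that the new division steps use: any excess between `1` and `M` over
a multiple of `M` becomes a full unit. -/
theorem ceil_mul_add_div {M : ℕ} (hM : 0 < M) {e : ℤ} (he : 1 ≤ e) (heM : e ≤ M) (b : ℤ) :
    ⌈((e + M * b : ℤ) : ℚ) / (M : ℚ)⌉ = b + 1 := by
  have hM' : (0 : ℚ) < M := by exact_mod_cast hM
  rw [Int.ceil_eq_iff]
  constructor
  · rw [lt_div_iff₀ hM']
    have : (1 : ℚ) ≤ e := by exact_mod_cast he
    push_cast
    linarith
  · rw [div_le_iff₀ hM']
    have : (e : ℚ) ≤ M := by exact_mod_cast heM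
    push_cast
    linarith

/-- If the face `a x = b` is refuted, then the valid inequality `a x ≥ b` can be improved to
`a x ≥ b + 1`. -/
theorem Derivable.improve {P : Set (LinIneq V)} {a : V → ℤ} {b : ℤ} {n : ℕ}
    (h : Derivable (insert ⟨-a, -b⟩ P) n ⟨0, 1⟩) :
    Derivable (insert ⟨a, b⟩ P) (2 * n + 2) ⟨a, b + 1⟩ := by
  obtain ⟨L, hL, hl, hn⟩ := h
  obtain ⟨L', hL', hab, hlen, hM⟩ := hL.lift
  obtain ⟨M, hM⟩ := hM _ hl
  -- The lifted contradiction is `M * (a x) ≥ M * b + 1`. For `M = 0` it is `0 ≥ 1` itself, to be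
  -- added to `a x ≥ b`; otherwise division by `M` rounds up.
  rcases Nat.eq_zero_or_pos M with rfl | hpos
  · refine ⟨⟨a, b + 1⟩ :: L', .cons hL' (.comb hM hab 1 1 ?_ ?_), by simp, by simp; omega⟩
    · simp
    · simp [add_comm]
  · have h' : Derivable (insert ⟨a, b⟩ P) (2 * n + 1) _ := ⟨L', hL', hM, by omega⟩
    refine h'.div hpos (by simp) ?_
    exact (ceil_mul_add_div hpos le_rfl (by exact_mod_cast hpos) b).symm

/-- Branching on the value of `a x` within its range `{lo, …, lo + R}`. -/
theorem Derivable.branch {P : Set (LinIneq V)} {a : V → ℤ} {lo : ℤ} {R g n : ℕ}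
    (hlo : Derivable P g ⟨a, lo⟩) (hhi : Derivable P g ⟨-a, -(lo + R)⟩)
    (h : ∀ c : ℤ, Derivable (insert ⟨-a, -c⟩ (insert ⟨a, c⟩ P)) n ⟨0, 1⟩) :
    Derivable P (2 * g + 1 + (R + 1) * (2 * n + 2)) ⟨0, 1⟩ := by
  -- Refuting the face at the current lower bound raises that bound by one; past `lo + R` it
  -- contradicts the upper bound.
  have key : ∀ j : ℕ, Derivable P (g + j * (2 * n + 2)) ⟨a, lo + j⟩ := by
    intro j
    induction j with
    | zero => simpa using hlo
    | succ j ih =>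
      have h' := (h (lo + j)).improve
      rw [Set.insert_idem] at h'
      have e₁ : g + (j + 1) * (2 * n + 2) = g + j * (2 * n + 2) + (2 * n + 2) := by ring
      have e₂ : lo + (j + 1 : ℕ) = lo + j + 1 := by push_cast; ring
      rw [e₁, e₂]
      exact ih.cut h'
  refine ((key (R + 1)).comb hhi 1 1 ?_ ?_).mono subset_rfl ?_
  · simp
  · simp
    ring
  · ring_nf
    omega

theorem IsDerivation.of_append {P : Set (LinIneq V)} {L L' : List (LinIneq V)}
    (h : IsDerivation P (L' ++ L)) : IsDerivation P L := by
  induction L' with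
  | nil => exact h
  | cons l L' ih =>
    cases h with
    | cons h _ => exact ih h

theorem IsDerivation.isCPProof {P : Set (LinIneq V)} {L : List (LinIneq V)}
    (h : IsDerivation P L) : IsCPProof P fun i : Fin L.length => L.get i.rev := by
  induction h with
  | nil => exact fun i => i.elim0
  | @cons l L _ hs ih =>
    intro i
    induction i using Fin.lastCases with
    | last =>
      simp only [Fin.rev_last]
      refine CPStep.mono subset_rfl ?_ hs
      intro x hx
      obtain ⟨j, rfl⟩ := List.get_of_mem hx
      refine ⟨j.rev.castSucc, Fin.castSucc_lt_last _, ?_⟩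
      simp [Fin.rev_castSucc]
    | cast i =>
      have := ih i
      simp only [Fin.rev_castSucc]
      refine CPStep.mono subset_rfl ?_ this
      rintro x ⟨j, hj, rfl⟩
      refine ⟨j.castSucc, by simpa using hj, ?_⟩
      simp [Fin.rev_castSucc]

theorem Derivable.exists_refutation {P : Set (LinIneq V)} {n : ℕ} (h : Derivable P n ⟨0, 1⟩) :
    ∃ s ≤ n, ∃ π : Fin s → LinIneq V, IsCPRefutation P π := by
  obtain ⟨L, hL, hl, hn⟩ := h
  -- `L₁` holds the lines derived after `0 ≥ 1`; they are dropped, as a refutation has to end there.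
  obtain ⟨L₁, L₂, rfl⟩ := List.append_of_mem hl
  refine ⟨(⟨0, 1⟩ :: L₂ : List (LinIneq V)).length, ?_, _, hL.of_append.isCPProof, Fin.last _, ?_⟩
  · simp at hn ⊢
    omega
  · simp
    rfl

end Derivations

/-! ### Refuting a contradictory sum of equations modulo `p` -/

section Sums

variable {V ι : Type*}

/-- If the value of each `α i x` modulo `p` is forced, in the sense that every other value can be
refuted, then every value of `(∑ i ∈ T, α i) x` other than the sum of the forced ones can be refuted,
by halving `T` and branching on the value of one half. -/
theorem Derivable.refute_sum {p : ℕ} {P : Set (LinIneq V)} (S : Finset ι) (α : ι → V → ℤ)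
    (β : ι → ZMod p) {g R X : ℕ}
    (hbound : ∀ T ⊆ S, ∃ lo : ℤ, ∃ r ≤ R, Derivable P g ⟨∑ i ∈ T, α i, lo⟩ ∧
      Derivable P g ⟨-∑ i ∈ T, α i, -(lo + r)⟩)
    (hleaf : ∀ i ∈ S, ∀ c : ℤ, (c : ZMod p) ≠ β i →
      Derivable (insert ⟨-α i, -c⟩ (insert ⟨α i, c⟩ P)) X ⟨0, 1⟩)
    (hX : 2 * g + 1 + 16 * (R + 1) ≤ X) (t : ℕ) (T : Finset ι) (hT : T ⊆ S) (hne : T.Nonempty)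
    (hcard : T.card ≤ 2 ^ t) (c : ℤ) (hc : (c : ZMod p) ≠ ∑ i ∈ T, β i) :
    Derivable (insert ⟨-∑ i ∈ T, α i, -c⟩ (insert ⟨∑ i ∈ T, α i, c⟩ P)) (X ^ (t + 1)) ⟨0, 1⟩ := by
  classical
  induction t generalizing T c with
  | zero =>
    have h1 : T.card = 1 := le_antisymm (by simpa using hcard) hne.card_pos
    obtain ⟨i, rfl⟩ := Finset.card_eq_one.1 h1
    simpa using hleaf i (hT (by simp)) c (by simpa using hc)
  | succ t ih =>
    have hX1 : 1 ≤ X := by omega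
    by_cases hsmall : T.card ≤ 2 ^ t
    · exact (ih T hT hne hsmall c hc).mono subset_rfl (Nat.pow_le_pow_right hX1 (by omega))
    push Not at hsmall
    obtain ⟨T₁, hT₁, hcard₁⟩ := Finset.exists_subset_card_eq hsmall.le
    have hcard₂ : (T \ T₁).card = T.card - 2 ^ t := by
      rw [Finset.card_sdiff_of_subset hT₁, hcard₁]
    have hne₁ : T₁.Nonempty := by
      rw [← Finset.card_pos, hcard₁]
      positivity
    have hne₂ : (T \ T₁).Nonempty := by
      rw [← Finset.card_pos]
      omega
    have hle₂ : (T \ T₁).card ≤ 2 ^ t := by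
      rw [hcard₂]
      rw [pow_succ] at hcard
      omega
    have hα : ∑ i ∈ T \ T₁, α i + ∑ i ∈ T₁, α i = ∑ i ∈ T, α i := Finset.sum_sdiff hT₁
    have hβ : ∑ i ∈ T \ T₁, β i + ∑ i ∈ T₁, β i = ∑ i ∈ T, β i := Finset.sum_sdiff hT₁
    obtain ⟨lo, r, hr, hlo, hhi⟩ := hbound T₁ (hT₁.trans hT)
    set P' := insert (⟨-∑ i ∈ T, α i, -c⟩ : LinIneq V) (insert ⟨∑ i ∈ T, α i, c⟩ P) with hP'
    have hPP' : P ⊆ P' := (Set.subset_insert _ _).trans (Set.subset_insert _ _)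
    have hY : ∀ d : ℤ, Derivable (insert ⟨-∑ i ∈ T₁, α i, -d⟩ (insert ⟨∑ i ∈ T₁, α i, d⟩ P'))
        (X ^ (t + 1) + 6) ⟨0, 1⟩ := by
      intro d
      -- If `T₁` has the forced residue, the complement has the value `c - d`, whose residue is
      -- wrong; its two bounds cost three lines each, hence the `6`. Otherwise `T₁` itself is wrong.
      by_cases hd : (d : ZMod p) = ∑ i ∈ T₁, β i
      · have hcd : ((c - d : ℤ) : ZMod p) ≠ ∑ i ∈ T \ T₁, β i := by
          intro h
          apply hc
          rw [← hβ, ← h, ← hd]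
          push_cast
          ring
        have h₂ := ih (T \ T₁) (Finset.sdiff_subset.trans hT) hne₂ hle₂ (c - d) hcd
        set P'' := insert (⟨-∑ i ∈ T₁, α i, -d⟩ : LinIneq V) (insert ⟨∑ i ∈ T₁, α i, d⟩ P')
        have hge : Derivable P'' 3 ⟨∑ i ∈ T \ T₁, α i, c - d⟩ := by
          have h1 : Derivable P'' 1 ⟨∑ i ∈ T, α i, c⟩ := .of_mem (by simp [P'', P'])
          have h2 : Derivable P'' 1 ⟨-∑ i ∈ T₁, α i, -d⟩ := .of_mem (by simp [P''])
          refine h1.comb h2 1 1 ?_ ?_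
          · intro v
            have := congrFun hα v
            simp only [Pi.add_apply] at this
            simp only [← this, Pi.neg_apply]
            push_cast
            ring
          · simp
            ring
        have hle : Derivable (insert ⟨∑ i ∈ T \ T₁, α i, c - d⟩ P'') 3
            ⟨-∑ i ∈ T \ T₁, α i, -(c - d)⟩ := by
          have h1 : Derivable (insert ⟨∑ i ∈ T \ T₁, α i, c - d⟩ P'') 1 ⟨-∑ i ∈ T, α i, -c⟩ :=
            .of_mem (by simp [P'', P'])
          have h2 : Derivable (insert ⟨∑ i ∈ T \ T₁, α i, c - d⟩ P'') 1 ⟨∑ i ∈ T₁, α i, d⟩ :=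
            .of_mem (by simp [P''])
          refine h1.comb h2 1 1 ?_ ?_
          · intro v
            have := congrFun hα v
            simp only [Pi.add_apply] at this
            simp only [← this, Pi.neg_apply]
            push_cast
            ring
          · simp
            ring
        have hsub : P ⊆ P'' :=
          hPP'.trans ((Set.subset_insert _ _).trans (Set.subset_insert _ _))
        have := hge.cut (hle.cut (h₂.mono
          (Set.insert_subset_insert (Set.insert_subset_insert hsub)) le_rfl))
        exact this.mono subset_rfl (by omega)
      · exact (ih T₁ (hT₁.trans hT) hne₁ hcard₁.le d hd).mono
          (Set.insert_subset_insert (Set.insert_subset_insert hPP')) (by omega)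
    refine ((hlo.mono hPP' le_rfl).branch (hhi.mono hPP' le_rfl) hY).mono subset_rfl ?_
    have hpos : 1 ≤ X ^ (t + 1) := Nat.one_le_pow _ _ hX1
    -- With `Y = X ^ (t + 1) ≥ 1`, the cost of a branch is `2 * (Y + 6) + 2 ≤ 16 * Y`.
    calc 2 * g + 1 + (r + 1) * (2 * (X ^ (t + 1) + 6) + 2)
        ≤ (2 * g + 1) * X ^ (t + 1) + (R + 1) * (16 * X ^ (t + 1)) := by
          gcongr
          · exact Nat.le_mul_of_pos_right _ hpos
          · omega
      _ = (2 * g + 1 + 16 * (R + 1)) * X ^ (t + 1) := by ring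
      _ ≤ X * X ^ (t + 1) := by gcongr
      _ = X ^ (t + 1 + 1) := by ring

end Sums

/-! ### Boolean reasoning in Cutting Planes -/

section Boolean

variable {V : Type*} [DecidableEq V]

/-- The coefficient of `x` in the distance of `x` from the bit `b`, which is `x` or `1 - x`. -/
def bitSign (b : Bool) : ℤ := if b then -1 else 1

/-- The bit as an integer. -/
def bitVal (b : Bool) : ℤ := if b then 1 else 0

/-- The system contains the inequalities `0 ≤ x v ≤ 1`, that is, the distance of `x v` from each of
the two bits is non-negative. -/
def HasBounds (P : Set (LinIneq V)) : Prop :=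
  ∀ v b, (⟨Pi.single v (bitSign b), -bitVal b⟩ : LinIneq V) ∈ P

theorem HasBounds.mono {P P' : Set (LinIneq V)} (h : HasBounds P) (hP : P ⊆ P') : HasBounds P' :=
  fun v b => hP (h v b)

theorem CNF.hasBounds (F : CNF V) : HasBounds F.system := by
  intro v b
  cases b
  · exact Or.inl ⟨v, by simp [bitSign, bitVal]⟩
  · exact Or.inr (Or.inl ⟨v, by simp [bitSign, bitVal]⟩)

/-- The inequality of the clause that rules out the assignments agreeing with `τ` on `B`. -/
def clauseIneq (B : Finset V) (τ : V → Bool) : LinIneq V :=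
  ⟨fun v => if v ∈ B then bitSign (τ v) else 0, 1 - ∑ v ∈ B, bitVal (τ v)⟩

theorem ruleOut_toIneq (B : Finset V) (τ : V → Bool) :
    (ruleOut B τ).toIneq = clauseIneq B τ := by
  have hmem : ∀ v b, (v, b) ∈ ruleOut B τ ↔ v ∈ B ∧ (!τ v) = b := by
    intro v b
    simp [ruleOut]
  ext v
  · simp only [Clause.toIneq, clauseIneq, hmem]
    by_cases hv : v ∈ B <;> cases h : τ v <;> simp [hv, bitSign]
  · simp only [Clause.toIneq, clauseIneq]
    have : ((ruleOut B τ).filter fun ℓ => ℓ.2 = false) =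
        (B.filter fun v => τ v = true).image fun v => (v, false) := by
      ext ⟨v, b⟩
      simp only [Finset.mem_filter, hmem, Finset.mem_image, Prod.mk.injEq]
      constructor
      · rintro ⟨⟨hv, h⟩, rfl⟩
        exact ⟨v, ⟨hv, by simpa using h⟩, rfl, rfl⟩
      · rintro ⟨w, ⟨hw, h⟩, rfl, rfl⟩
        exact ⟨⟨hw, by simp [h]⟩, rfl⟩
    rw [this, Finset.card_image_of_injective _ (fun a b h => by simpa using h)]
    simp [bitVal]

namespace Derivable

/-- Non-negative combinations of the distances of the variables from the bits of `τ`. -/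
theorem dist_sum {P : Set (LinIneq V)} (hP : P.Nonempty) (hb : HasBounds P) (B : Finset V)
    (τ : V → Bool) (r : V → ℕ) :
    Derivable P (2 + B.card * 2) ⟨fun v => if v ∈ B then r v * bitSign (τ v) else 0,
      -∑ v ∈ B, r v * bitVal (τ v)⟩ := by
  have h := sum hP B (fun v => Pi.single v (bitSign (τ v))) (fun v => -bitVal (τ v)) r (n := 1)
    fun v _ => .of_mem (hb v (τ v))
  convert h using 2
  · funext v
    simp [Pi.single_apply]
  · simp

/-- `lo` is the minimum of the form on the cube, taken with bit `1` exactly at the negative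
coefficients; the opposite bits give the maximum. The length of the range bounds the number of
branches. -/
theorem range_of_support {P : Set (LinIneq V)} (hP : P.Nonempty) (hb : HasBounds P) (B : Finset V)
    (α : V → ℤ) (hα : ∀ v ∉ B, α v = 0) :
    ∃ lo : ℤ, Derivable P (2 + B.card * 2) ⟨α, lo⟩ ∧
      Derivable P (2 + B.card * 2) ⟨-α, -(lo + (∑ v ∈ B, (α v).natAbs : ℕ))⟩ := by
  refine ⟨-∑ v ∈ B, (α v).natAbs * bitVal (decide (α v < 0)), ?_, ?_⟩
  · convert dist_sum hP hb B (fun v => decide (α v < 0)) (fun v => (α v).natAbs) using 2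
    funext v
    by_cases hv : v ∈ B
    · simp only [hv, if_true, bitSign, decide_eq_true_eq]
      split_ifs <;> omega
    · simp [hv, hα v hv]
  · convert dist_sum hP hb B (fun v => !decide (α v < 0)) (fun v => (α v).natAbs) using 2
    · funext v
      by_cases hv : v ∈ B
      · simp only [hv, if_true, bitSign, Pi.neg_apply]
        by_cases h : α v < 0
        · simp [h, abs_of_neg h]
        · simp [h, abs_of_nonneg (not_lt.1 h)]
      · simp [hv, hα v hv]
    · rw [neg_inj, Nat.cast_sum, neg_add_eq_iff_eq_add, ← Finset.sum_add_distrib]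
      refine Finset.sum_congr rfl fun v _ => ?_
      by_cases h : α v < 0 <;> simp [h, bitVal]

/-- The clause that rules out `τ` on `B` follows from an inequality in the variables of `B` that
`τ` falsifies. -/
theorem clause_of_ineq {P : Set (LinIneq V)} (hP : P.Nonempty) (hb : HasBounds P) (B : Finset V)
    (α : V → ℤ) (hα : ∀ v ∉ B, α v = 0) (c : ℤ) (hc : (⟨α, c⟩ : LinIneq V) ∈ P) (τ : V → Bool)
    (hτ : ∑ v ∈ B, α v * bitVal (τ v) < c) :
    Derivable P (B.card * 2 + 5) (clauseIneq B τ) := by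
  set e : ℤ := c - ∑ v ∈ B, α v * bitVal (τ v) with he
  -- The common size to which all coefficients are raised before dividing. It must exceed every `|α
  -- v|`, up to equality, for the added multiples of distances to be non-negative, and be at least
  -- `e`, the amount by which `τ` violates the inequality, for the rounding to gain exactly one.
  set A : ℕ := e.toNat + ∑ v ∈ B, (α v).natAbs with hA
  have hle : ∀ v ∈ B, ((α v).natAbs : ℤ) ≤ A := by
    intro v hv
    have := Finset.single_le_sum (f := fun v => (α v).natAbs) (fun _ _ => Nat.zero_le _) hv
    omega
  have h₁ := dist_sum hP hb B τ fun v => (A - α v * bitSign (τ v)).toNat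
  have hr : ∀ v ∈ B, (((A - α v * bitSign (τ v)).toNat : ℕ) : ℤ) = A - α v * bitSign (τ v) := by
    intro v hv
    have := hle v hv
    rw [Int.toNat_of_nonneg]
    cases τ v <;> simp [bitSign] <;> omega
  have h₂ := (of_mem hc).comb h₁ 1 1 (l := ⟨fun v => A * (clauseIneq B τ).coeff v,
    e + A * (-∑ v ∈ B, bitVal (τ v))⟩) ?_ ?_
  · refine (h₂.div (l := clauseIneq B τ) (d := A) (by omega) (fun v => rfl) ?_).mono subset_rfl
      (by omega)
    refine Eq.trans ?_ (ceil_mul_add_div (by omega) (by omega) (by omega) _).symm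
    simp [clauseIneq]
    ring
  · intro v
    by_cases hv : v ∈ B
    · simp only [clauseIneq, hv, if_true, hr v hv]
      cases τ v <;> simp [bitSign]
    · simp [clauseIneq, hv, hα v hv]
  · simp only [he, Nat.cast_one, one_mul, mul_neg, Finset.mul_sum]
    rw [sub_eq_add_neg, add_assoc, ← neg_add, ← Finset.sum_add_distrib]
    congr 2
    refine Finset.sum_congr rfl fun v hv => ?_
    rw [hr v hv]
    cases τ v <;> simp [bitSign, bitVal]
    ring

/-- The missing variables enter by adding their non-negative distances from `τ`; no rounding is
needed. -/
theorem clause_weaken {P : Set (LinIneq V)} (hP : P.Nonempty) (hb : HasBounds P) {B' B : Finset V}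
    (hB : B' ⊆ B) (τ : V → Bool) (h : clauseIneq B' τ ∈ P) :
    Derivable P (B.card * 2 + 5) (clauseIneq B τ) := by
  have h₁ := dist_sum hP hb (B \ B') τ fun _ => 1
  refine ((of_mem h).comb h₁ 1 1 ?_ ?_).mono subset_rfl ?_
  · intro v
    by_cases hv : v ∈ B <;> by_cases hv' : v ∈ B' <;> simp [clauseIneq, hv, hv']
    exact absurd (hB hv') hv
  · simp only [clauseIneq, Nat.cast_one, one_mul]
    rw [← Finset.sum_sdiff hB]
    ring
  · have := Finset.card_le_card (Finset.sdiff_subset : B \ B' ⊆ B)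
    omega

/-- Resolving all the clauses over the variables in `B`. -/
theorem refute_of_clauses {P : Set (LinIneq V)} (B : Finset V) {n : ℕ}
    (h : ∀ τ, Derivable P n (clauseIneq B τ)) : Derivable P (2 ^ B.card * (n + 2)) ⟨0, 1⟩ := by
  induction B using Finset.induction_on generalizing n with
  | empty =>
    refine Derivable.mono (n := n) ?_ subset_rfl (by simp)
    simpa [clauseIneq, Pi.zero_def] using h fun _ => false
  | insert w B hw ih =>
    -- Resolution on `w`: in the sum of the two clauses `w` cancels and the rest doubles, so halving
    -- rounds to the resolvent. The cost `n` becomes `2 * n + 2`, that is, `n + 2` doubles.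
    have key : ∀ τ, Derivable P (2 * n + 2) (clauseIneq B τ) := by
      intro τ
      have hs : ∀ b, ∑ v ∈ B, bitVal (Function.update τ w b v) = ∑ v ∈ B, bitVal (τ v) := by
        intro b
        refine Finset.sum_congr rfl fun v hv => ?_
        rw [Function.update_of_ne]
        rintro rfl
        exact hw hv
      have h₁ := (h (Function.update τ w true)).comb (h (Function.update τ w false)) 1 1
        (l := ⟨fun v => (2 : ℕ) * (clauseIneq B τ).coeff v, 1 + (2 : ℕ) *
          (-∑ v ∈ B, bitVal (τ v))⟩) ?_ ?_
      · refine (h₁.div (d := 2) (by omega) (fun v => rfl) ?_).mono subset_rfl (by omega)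
        refine Eq.trans ?_ (ceil_mul_add_div (by omega) le_rfl (by omega) _).symm
        simp [clauseIneq]
        ring
      · intro v
        by_cases hv : v = w
        · subst hv
          simp [clauseIneq, hw, bitSign]
        · simp [clauseIneq, hv]
          split_ifs <;> ring
      · simp only [clauseIneq, Finset.sum_insert hw, hs]
        simp [bitVal]
        ring
    refine (ih key).mono subset_rfl ?_
    rw [Finset.card_insert_of_notMem hw, pow_succ]
    ring_nf
    omega

end Derivable

end Boolean

/-! ### Linear algebra -/

/-- Residues with sum `0` have small integer representatives with sum `0`. -/
theorem exists_int_lift_sum_eq_zero {ι : Type*} {p : ℕ} [NeZero p] (S : Finset ι) (a : ι → ZMod p)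
    (h : ∑ i ∈ S, a i = 0) : ∃ α : ι → ℤ, (∀ i, (α i : ZMod p) = a i) ∧
      (∀ i, a i = 0 → α i = 0) ∧ (∀ i, (α i).natAbs ≤ p) ∧ ∑ i ∈ S, α i = 0 := by
  classical
  have hp : 0 < p := Nat.pos_of_ne_zero (NeZero.ne p)
  -- Greedy choice between the representatives `val` and `val - p`, keeping the partial sums in `[0,
  -- p)`. The full sum is then a multiple of `p` in this interval.
  have key : ∀ T : Finset ι, ∃ α : ι → ℤ, (∀ i, (α i : ZMod p) = a i) ∧
      (∀ i, a i = 0 → α i = 0) ∧ (∀ i, (α i).natAbs ≤ p) ∧ 0 ≤ ∑ i ∈ T, α i ∧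
      ∑ i ∈ T, α i < p := by
    intro T
    induction T using Finset.induction_on with
    | empty =>
      refine ⟨fun i => (a i).val, by simp, by simp +contextual, fun i => ?_, by simp,
        by simpa using hp⟩
      exact (Int.natAbs_natCast _).trans_le (a i).val_lt.le
    | insert i T hi ih =>
      obtain ⟨α, h₁, h₂, h₃, h₄, h₅⟩ := ih
      have hlt := (a i).val_lt
      have hs : ∀ x, ∑ j ∈ insert i T, Function.update α i x j = x + ∑ j ∈ T, α j := by
        intro x
        rw [Finset.sum_insert hi, Function.update_self]
        congr 1
        refine Finset.sum_congr rfl fun j hj => Function.update_of_ne ?_ _ _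
        rintro rfl
        exact hi hj
      have gen : ∀ x : ℤ, (x : ZMod p) = a i → (a i = 0 → x = 0) → x.natAbs ≤ p →
          0 ≤ x + ∑ j ∈ T, α j → x + ∑ j ∈ T, α j < p → ∃ α : ι → ℤ,
          (∀ i, (α i : ZMod p) = a i) ∧ (∀ i, a i = 0 → α i = 0) ∧ (∀ i, (α i).natAbs ≤ p) ∧
          0 ≤ ∑ j ∈ insert i T, α j ∧ ∑ j ∈ insert i T, α j < p := by
        intro x hx₁ hx₂ hx₃ hx₄ hx₅
        refine ⟨Function.update α i x, ?_, ?_, ?_, by rwa [hs], by rwa [hs]⟩ <;> intro j <;>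
          by_cases hj : j = i
        · subst hj; simpa using hx₁
        · simpa [hj] using h₁ j
        · subst hj; simpa using hx₂
        · simpa [hj] using h₂ j
        · subst hj; simpa using hx₃
        · simpa [hj] using h₃ j
      by_cases hsum : ((a i).val : ℤ) + ∑ j ∈ T, α j < p
      · exact gen (a i).val (by simp) (by simp +contextual) (by omega) (by omega) hsum
      · refine gen ((a i).val - p) (by simp) ?_ (by omega) (by omega) (by omega)
        -- A zero residue cannot push the sum to `p`, so its representative stays `0`.
        intro h0
        simp only [h0, ZMod.val_zero] at hsum
        omega
  obtain ⟨α, h₁, h₂, h₃, h₄, h₅⟩ := key S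
  refine ⟨α, h₁, h₂, h₃, ?_⟩
  have hdvd : (p : ℤ) ∣ ∑ i ∈ S, α i := by
    rw [← ZMod.intCast_zmod_eq_zero_iff_dvd]
    push_cast
    simpa [h₁] using h
  exact Int.eq_zero_of_dvd_of_nonneg_of_lt h₄ h₅ hdvd

/-- An unsatisfiable system of linear equations has a linear combination `0 = 1`. -/
theorem exists_dual_certificate {K ι : Type*} [Field K] [Fintype ι] {n : ℕ} (S : Finset ι)
    (A : Matrix ι (Fin n) K) (b : ι → K)
    (h : ¬ ∃ z : Fin n → K, ∀ i ∈ S, ∑ j, A i j * z j = b i) :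
    ∃ c : ι → K, (∀ j, ∑ i ∈ S, c i * A i j = 0) ∧ ∑ i ∈ S, c i * b i ≠ 0 := by
  classical
  let f : (Fin n → K) →ₗ[K] (S → K) := Matrix.mulVecLin (A.submatrix (fun i : S => (i : ι)) id)
  have hf : ∀ z i, f z i = ∑ j, A i j * z j := fun z i => rfl
  have hb : (fun i : S => b i) ∉ LinearMap.range f := by
    rintro ⟨z, hz⟩
    exact h ⟨z, fun i hi => by rw [← hf z ⟨i, hi⟩, hz]⟩
  -- A functional that vanishes on the range but not at `b`; its values on the unit vectors are the
  -- multipliers.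
  obtain ⟨g, hgb, hg⟩ := Submodule.exists_le_ker_of_notMem hb
  have hg_apply : ∀ y : ι → K, g (fun i : S => y i) =
      ∑ i ∈ S, (if hi : i ∈ S then g (Pi.single ⟨i, hi⟩ 1) else 0) * y i := by
    intro y
    rw [LinearMap.pi_apply_eq_sum_univ g, ← Finset.sum_coe_sort S]
    refine Finset.sum_congr rfl fun i _ => ?_
    simp only [i.2, dif_pos, smul_eq_mul]
    rw [mul_comm]
    congr 2
    funext j
    simp [Pi.single_apply, eq_comm]
  refine ⟨_, fun j => ?_, by rw [← hg_apply]; exact hgb⟩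
  rw [← hg_apply fun i => A i j]
  have := hg ⟨Pi.single j 1, rfl⟩
  rw [LinearMap.mem_ker] at this
  rw [← this]
  congr 1
  funext i
  simp [hf, Pi.single_apply]

/-! ### The bit encoding -/

theorem ofBits_eq_sum {n : ℕ} (f : Fin n → Bool) :
    Nat.ofBits f = ∑ i : Fin n, 2 ^ (i : ℕ) * (f i).toNat := by
  induction n with
  | zero => simp
  | succ n ih =>
    rw [Nat.ofBits_succ, ih, Fin.sum_univ_succ, Finset.mul_sum, add_comm]
    simp [pow_succ]
    refine Finset.sum_congr rfl fun i _ => ?_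
    ring

theorem ruleOut_congr {V : Type*} [DecidableEq V] {S : Finset V} {τ τ' : V → Bool}
    (h : ∀ v ∈ S, τ v = τ' v) : ruleOut S τ = ruleOut S τ' :=
  Finset.image_congr fun v hv => by simp [h v hv]

/-- A clause shows the sign of each of its variables. This makes the maps from assignments to
clauses injective in the counting arguments below. -/
theorem eq_of_ruleOut_eq {V : Type*} [DecidableEq V] {S S' : Finset V} {τ τ' : V → Bool}
    (h : ruleOut S τ = ruleOut S' τ') {v : V} (hv : v ∈ S) : τ v = τ' v := by
  have : (v, !τ v) ∈ ruleOut S' τ' := by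
    rw [← h]
    exact Finset.mem_image_of_mem _ hv
  simp only [ruleOut, Finset.mem_image, Prod.mk.injEq] at this
  obtain ⟨w, _, rfl, hw⟩ := this
  simpa using hw.symm

theorem clauseIneq_congr {V : Type*} [DecidableEq V] {S : Finset V} {τ τ' : V → Bool}
    (h : ∀ v ∈ S, τ v = τ' v) : clauseIneq S τ = clauseIneq S τ' := by
  rw [← ruleOut_toIneq, ← ruleOut_toIneq, ruleOut_congr h]

section Encoding

variable {K : Type*} [Field K] [Fintype K] [DecidableEq K] {p : ℕ} [Fact p.Prime]
  [Algebra (ZMod p) K] {k m n : ℕ}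

omit [Fintype K] [DecidableEq K] in
theorem eq_of_bits_eq (β : Module.Basis (Fin k) (ZMod p) K) {z z' : Fin n → K} {j : Fin n}
    (h : ∀ κ l, bits β z (j, κ, l) = bits β z' (j, κ, l)) : z j = z' j := by
  apply β.repr.injective
  ext κ
  apply ZMod.val_injective p
  apply Nat.eq_of_testBit_eq
  intro l
  have hlt : ∀ y : ZMod p, y.val < 2 ^ Nat.clog 2 p := fun y =>
    y.val_lt.trans_le (Nat.le_pow_clog one_lt_two p)
  by_cases hl : l < Nat.clog 2 p
  · exact h κ ⟨l, hl⟩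
  · have hle : 2 ^ Nat.clog 2 p ≤ 2 ^ l := Nat.pow_le_pow_right two_pos (not_lt.1 hl)
    rw [Nat.testBit_lt_two_pow ((hlt _).trans_le hle), Nat.testBit_lt_two_pow ((hlt _).trans_le hle)]

/-- The `𝔽_p`-linear consequence `ψ (∑ j, a j * z j) = ψ e` of an equation, written as an equation
modulo `p` in the bits: each integer value of the left-hand side that does not satisfy it is refuted
by going through all the assignments to the bits. -/
theorem Derivable.refute_equation (β : Module.Basis (Fin k) (ZMod p) K) (a : Fin n → K) (e : K)
    (ψ : K →ₗ[ZMod p] ZMod p) (α : BitVar p k n → ℤ)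
    (hα : ∀ v, (α v : ZMod p) = 2 ^ (v.2.2 : ℕ) * ψ (a v.1 * β v.2.1))
    (hα₀ : ∀ v, v.1 ∉ occurring a → α v = 0) (F : CNF (BitVar p k n))
    (hF : equationClauses β a e ⊆ F) (hR : ∀ j ∈ occurring a, rangeClauses p k j ⊆ F) (c : ℤ)
    (hc : (c : ZMod p) ≠ ψ e) {N : ℕ} (hN : (occurring a).card * (k * Nat.clog 2 p) ≤ N) :
    Derivable (insert ⟨-α, -c⟩ (insert ⟨α, c⟩ F.system)) (2 ^ N * (N * 2 + 7)) ⟨0, 1⟩ := by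
  set B : Finset (BitVar p k n) := occurring a ×ˢ Finset.univ with hB
  have hBN : B.card ≤ N := by
    refine le_trans (le_of_eq ?_) hN
    simp [hB, Finset.card_product]
  have hα_B : ∀ v ∉ B, α v = 0 := fun v hv => hα₀ v (by simpa [hB] using hv)
  set P := insert (⟨-α, -c⟩ : LinIneq (BitVar p k n)) (insert ⟨α, c⟩ F.system) with hP
  have hsub : F.system ⊆ P := (Set.subset_insert _ _).trans (Set.subset_insert _ _)
  have hne : P.Nonempty := ⟨_, Set.mem_insert _ _⟩
  have hb : HasBounds P := F.hasBounds.mono hsub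
  have hclause : ∀ B' τ, ruleOut B' τ ∈ F → clauseIneq B' τ ∈ P := fun B' τ h =>
    hsub (Or.inr (Or.inr ⟨_, h, (ruleOut_toIneq B' τ).symm⟩))
  suffices h : ∀ τ, Derivable P (B.card * 2 + 5) (clauseIneq B τ) by
    refine (refute_of_clauses B h).mono subset_rfl ?_
    exact Nat.mul_le_mul (Nat.pow_le_pow_right two_pos hBN) (by omega)
  intro τ
  let t : Fin n → Fin k → ℕ := fun j κ => Nat.ofBits fun l => τ (j, κ, l)
  have ht : ∀ j κ (l : Fin (Nat.clog 2 p)), (t j κ).testBit l = τ (j, κ, l) := by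
    intro j κ l
    simp [t]
  -- Three kinds of `τ`: a coordinate is out of range, and a range clause applies; `τ` encodes a
  -- falsifying assignment, and an equation clause applies; or it encodes a solution, where the form
  -- is congruent to `ψ e`, so differs from `c` and violates one of the two added inequalities.
  by_cases hrange : ∃ j ∈ occurring a, ∃ κ, p ≤ t j κ
  · obtain ⟨j, hj, κ, hp⟩ := hrange
    refine clause_weaken hne hb (B' := {j} ×ˢ ({κ} ×ˢ Finset.univ)) ?_ τ (hclause _ _ ?_)
    · intro v hv
      simp only [Finset.mem_product, Finset.mem_singleton] at hv
      simp [hB, hv.1, hj]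
    · apply hR j hj
      simp only [rangeClauses, Finset.mem_biUnion, Finset.mem_univ, true_and, Finset.mem_image,
        Finset.mem_Ico]
      refine ⟨κ, t j κ, ⟨hp, Nat.ofBits_lt_two_pow _⟩, ruleOut_congr ?_⟩
      rintro ⟨j', κ', l⟩ hv
      simp only [Finset.mem_product, Finset.mem_singleton] at hv
      obtain ⟨rfl, rfl, -⟩ := hv
      exact ht _ _ l
  · push Not at hrange
    let z : Fin n → K := fun j => ∑ κ, (t j κ : ZMod p) • β κ
    have hz : ∀ v ∈ B, bits β z v = τ v := by
      rintro ⟨j, κ, l⟩ hv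
      have hj : j ∈ occurring a := by simpa [hB] using hv
      simp only [bits, z, Module.Basis.repr_sum_self, ZMod.val_natCast,
        Nat.mod_eq_of_lt (hrange j hj κ), ht]
    by_cases hsat : ∑ j, a j * z j = e
    · have hval : ((∑ v ∈ B, α v * bitVal (τ v) : ℤ) : ZMod p) = ψ e := by
        rw [Finset.sum_subset (Finset.subset_univ B) fun v _ hv => by rw [hα_B v hv, zero_mul],
          ← hsat, map_sum, Fintype.sum_prod_type, Int.cast_sum]
        refine Finset.sum_congr rfl fun j _ => ?_
        simp only [z]
        rw [Fintype.sum_prod_type, Finset.mul_sum, map_sum, Int.cast_sum]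
        refine Finset.sum_congr rfl fun κ _ => ?_
        rw [mul_smul_comm, map_smul, smul_eq_mul, show t j κ = _ from ofBits_eq_sum _]
        push_cast
        rw [Finset.sum_mul]
        refine Finset.sum_congr rfl fun l _ => ?_
        rw [hα]
        cases τ (j, κ, l) <;> simp [bitVal]
      have hne' : ∑ v ∈ B, α v * bitVal (τ v) ≠ c := by
        rintro rfl
        exact hc hval
      rcases lt_or_gt_of_ne hne' with hlt | hlt
      · exact clause_of_ineq hne hb B α hα_B c (by simp [hP]) τ hlt
      · refine clause_of_ineq hne hb B (-α) (fun v hv => by simp [hα_B v hv]) (-c) (by simp [hP])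
          τ ?_
        simpa using hlt
    · refine clause_weaken hne hb subset_rfl τ ?_
      rw [← clauseIneq_congr hz]
      apply hclause
      apply hF
      simp only [equationClauses, Finset.mem_image, Finset.mem_filter, Finset.mem_univ, true_and]
      exact ⟨z, hsat, rfl⟩

/-- At least half of the assignments to the occurring variables falsify an equation with a variable,
and they have different clauses. -/
theorem card_pow_le_two_mul_card_equationClauses (β : Module.Basis (Fin k) (ZMod p) K)
    (a : Fin n → K) (e : K) (ha : (occurring a).Nonempty) :
    Fintype.card K ^ (occurring a).card ≤ 2 * (equationClauses β a e).card := by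
  classical
  obtain ⟨j₀, hj₀⟩ := ha
  let ext : (occurring a → K) → Fin n → K := fun f j => if h : j ∈ occurring a then f ⟨j, h⟩ else 0
  let val : (occurring a → K) → K := fun f => ∑ j, a j * ext f j
  -- Adding `1` at `j₀` changes the value by `a j₀ ≠ 0`, which injects the satisfying assignments
  -- into the falsifying ones.
  have hval : ∀ f, val (f + Pi.single ⟨j₀, hj₀⟩ 1) = val f + a j₀ := by
    intro f
    have : ∀ j, a j * ext (f + Pi.single ⟨j₀, hj₀⟩ 1) j =
        a j * ext f j + if j = j₀ then a j₀ else 0 := by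
      intro j
      by_cases hj : j ∈ occurring a
      · by_cases hjj : j = j₀
        · subst hjj
          simp [ext, hj, mul_add]
        · simp [ext, hj, hjj]
      · have hjj : j ≠ j₀ := fun h => hj (h ▸ hj₀)
        simp [ext, hj, hjj]
    simp only [val, this, Finset.sum_add_distrib]
    simp
  have ha₀ : a j₀ ≠ 0 := by simpa [occurring] using hj₀
  have h₁ : (Finset.univ.filter fun f => val f = e).card ≤
      (Finset.univ.filter fun f => ¬ val f = e).card := by
    refine Finset.card_le_card_of_injOn (fun f => f + Pi.single ⟨j₀, hj₀⟩ 1) ?_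
      fun f _ g _ h => add_right_cancel h
    intro f hf
    simp only [Finset.coe_filter, Finset.mem_univ, true_and, Set.mem_ofPred_eq] at hf ⊢
    simp [hval, hf, ha₀]
  have h₂ : (Finset.univ.filter fun f => ¬ val f = e).card ≤ (equationClauses β a e).card := by
    refine Finset.card_le_card_of_injOn
      (fun f => ruleOut (occurring a ×ˢ Finset.univ) (bits β (ext f))) ?_ ?_
    · intro f hf
      simp only [Finset.coe_filter, Finset.mem_univ, true_and, Set.mem_ofPred_eq] at hf
      simp only [equationClauses, Finset.coe_image, Set.mem_image, Finset.coe_filter,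
        Finset.mem_univ, true_and, Set.mem_ofPred_eq]
      exact ⟨ext f, hf, rfl⟩
    · intro f _ g _ h
      funext ⟨j, hj⟩
      have := eq_of_bits_eq β (z := ext f) (z' := ext g) (j := j) fun κ l =>
        eq_of_ruleOut_eq h (by simp [hj])
      simpa [ext, hj] using this
  have h₃ := Finset.card_filter_add_card_filter_not (s := Finset.univ) fun f => val f = e
  rw [Finset.card_univ, Fintype.card_fun, Fintype.card_coe] at h₃
  omega

theorem equationClauses_subset (β : Module.Basis (Fin k) (ZMod p) K) (A : Matrix (Fin m) (Fin n) K)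
    (b : Fin m → K) (i : Fin m) : equationClauses β (A i) (b i) ⊆ linearSystemCNF β A b :=
  (Finset.subset_biUnion_of_mem (fun i => equationClauses β (A i) (b i))
    (Finset.mem_univ i)).trans Finset.subset_union_left

theorem rangeClauses_subset (β : Module.Basis (Fin k) (ZMod p) K) (A : Matrix (Fin m) (Fin n) K)
    (b : Fin m → K) (i : Fin m) {j : Fin n} (hj : j ∈ occurring (A i)) :
    rangeClauses p k j ⊆ linearSystemCNF β A b :=
  (Finset.subset_biUnion_of_mem (fun j => rangeClauses p k j)
    (Finset.mem_biUnion.2 ⟨i, Finset.mem_univ i, hj⟩)).trans Finset.subset_union_right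

/-- In a minimal unsatisfiable subsystem each equation has a clause of its own. -/
theorem card_le_card_linearSystemCNF (β : Module.Basis (Fin k) (ZMod p) K)
    (A : Matrix (Fin m) (Fin n) K) (b : Fin m → K) (S : Finset (Fin m))
    (hS : ∀ i ∈ S, ∃ z : Fin n → K, ∑ j, A i j * z j ≠ b i ∧
      ∀ i' ∈ S, i' ≠ i → ∑ j, A i' j * z j = b i') :
    S.card ≤ (linearSystemCNF β A b).card := by
  choose! z hz hz' using hS
  refine Finset.card_le_card_of_injOn
    (fun i => ruleOut (occurring (A i) ×ˢ Finset.univ) (bits β (z i))) ?_ ?_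
  · intro i hi
    apply equationClauses_subset β A b i
    simp only [equationClauses, Finset.mem_image, Finset.mem_filter, Finset.mem_univ, true_and]
    exact ⟨z i, hz i hi, rfl⟩
  -- With equal clauses, `z i` and `z i'` would agree on the variables of equation `i`, which `z i'`
  -- satisfies and `z i` does not.
  · intro i hi i' hi' h
    by_contra hne
    apply hz i hi
    rw [← hz' i' hi' i hi hne]
    refine Finset.sum_congr rfl fun j _ => ?_
    by_cases hj : A i j = 0
    · simp [hj]
    · rw [eq_of_bits_eq β (z := z i) (z' := z i') (j := j) fun κ l =>
        eq_of_ruleOut_eq h (by simp [occurring, hj])]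

end Encoding

/-! ### Assembling the refutation -/

section Refutation

variable {K : Type*} [Field K] [Fintype K] [DecidableEq K] {p : ℕ} [Fact p.Prime]
  [Algebra (ZMod p) K] {k m n : ℕ}

/-- Bounds on the number `W * (k * ⌈log₂ p⌉)` of bits of `W` elements of the field with `p ^ k` elements. -/
theorem bit_count_bounds (p k W : ℕ) [hp : Fact p.Prime] (hk : 0 < k) :
    2 ^ (W * (k * Nat.clog 2 p)) ≤ ((p ^ k) ^ W) ^ 2 ∧
      W * (k * Nat.clog 2 p) * p ≤ ((p ^ k) ^ W) ^ 4 := by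
  have hp2 : 2 ≤ p := hp.out.two_le
  constructor
  -- Rounding the logarithm up loses less than a factor 2, and `2 * p ≤ p ^ 2`.
  · have h : 2 ^ Nat.clog 2 p ≤ p ^ 2 := by
      have h₁ := Nat.pow_pred_clog_lt_self one_lt_two (x := p) (by omega)
      obtain ⟨r, hr⟩ : ∃ r, Nat.clog 2 p = r + 1 :=
        ⟨_, (Nat.succ_pred (Nat.clog_pos one_lt_two (by omega)).ne').symm⟩
      rw [hr] at h₁ ⊢
      simp only [Nat.pred_succ] at h₁
      rw [pow_succ]
      nlinarith
    calc 2 ^ (W * (k * Nat.clog 2 p)) = (2 ^ Nat.clog 2 p) ^ (k * W) := by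
          rw [← pow_mul]
          ring
      _ ≤ (p ^ 2) ^ (k * W) := Nat.pow_le_pow_left h _
      _ = ((p ^ k) ^ W) ^ 2 := by
          rw [← pow_mul, ← pow_mul, ← pow_mul]
          ring
  · rcases Nat.eq_zero_or_pos W with rfl | hW
    · simp
    set Q := (p ^ k) ^ W with hQ
    have hpq : p ≤ p ^ k := Nat.le_self_pow hk.ne' p
    have hqQ : p ^ k ≤ Q := Nat.le_self_pow hW.ne' _
    have h₁ : W ≤ Q := (Nat.lt_two_pow_self).le.trans (Nat.pow_le_pow_left (hp2.trans hpq) W)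
    have h₂ : k ≤ Q := (Nat.lt_two_pow_self).le.trans ((Nat.pow_le_pow_left hp2 k).trans hqQ)
    have h₃ : Nat.clog 2 p ≤ Q :=
      (Nat.clog_le_of_le_pow (Nat.lt_two_pow_self).le).trans (hpq.trans hqQ)
    calc W * (k * Nat.clog 2 p) * p ≤ Q * (Q * Q) * Q := by
          gcongr
          exact hpq.trans hqQ
      _ = Q ^ 4 := by ring

omit [DecidableEq K] in
theorem card_eq_of_basis (β : Module.Basis (Fin k) (ZMod p) K) : Fintype.card K = p ^ k := by
  rw [Module.card_fintype β, ZMod.card, Fintype.card_fin]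

/-- An unsatisfiable subsystem of at least two equations in at most `W` variables each is refuted in
quasi-polynomially many lines. -/
theorem Derivable.refute_system (β : Module.Basis (Fin k) (ZMod p) K)
    (A : Matrix (Fin m) (Fin n) K) (b : Fin m → K) (S : Finset (Fin m)) (hS2 : 2 ≤ S.card)
    (hS : ¬ ∃ z : Fin n → K, ∀ i ∈ S, ∑ j, A i j * z j = b i) {W : ℕ}
    (hW : ∀ i ∈ S, (occurring (A i)).card ≤ W) (hne : (linearSystemCNF β A b).Nonempty) :
    Derivable (linearSystemCNF β A b).system
      ((S.card * Fintype.card K ^ W) ^ (7 * (Nat.clog 2 S.card + 2))) ⟨0, 1⟩ := by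
  classical
  have hp : p.Prime := Fact.out
  have hk : 0 < k := by
    rcases Nat.eq_zero_or_pos k with rfl | h
    · have h₁ := card_eq_of_basis β
      have h₂ := Fintype.one_lt_card (α := K)
      simp at h₁
      omega
    · exact h
  set F := linearSystemCNF β A b with hF
  have hsys : F.system.Nonempty := by
    obtain ⟨C, hC⟩ := hne
    exact ⟨_, Or.inr (Or.inr ⟨C, hC, rfl⟩)⟩
  obtain ⟨c, hcA, hcb⟩ := exists_dual_certificate S A b hS
  obtain ⟨κ₀, hκ₀⟩ : ∃ κ, β.coord κ (∑ i ∈ S, c i * b i) ≠ 0 := by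
    by_contra! h
    exact hcb (β.forall_coord_eq_zero_iff.1 h)
  let ψ : Fin m → K →ₗ[ZMod p] ZMod p := fun i => β.coord κ₀ ∘ₗ LinearMap.mulLeft (ZMod p) (c i)
  have hψ : ∀ i x, ψ i x = β.coord κ₀ (c i * x) := fun i x => rfl
  have hsum : ∀ v : BitVar p k n,
      ∑ i ∈ S, 2 ^ (v.2.2 : ℕ) * ψ i (A i v.1 * β v.2.1) = 0 := by
    intro v
    rw [← Finset.mul_sum]
    simp only [hψ, ← mul_assoc]
    rw [← map_sum, ← Finset.sum_mul, hcA, zero_mul, map_zero, mul_zero]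
  -- The lift is made separately for each bit, across the equations, so that its coefficients in all
  -- the forms cancel over the integers.
  choose α hα hα₀ hαp hαS using fun v => exists_int_lift_sum_eq_zero S _ (hsum v)
  set N := W * (k * Nat.clog 2 p) with hN
  set Q := Fintype.card K ^ W with hQ
  set M := S.card with hM
  obtain ⟨hb₁, hb₂⟩ := bit_count_bounds p k W hk
  rw [← card_eq_of_basis β, ← hQ, ← hN] at hb₁ hb₂
  have hQ1 : 1 ≤ Q := Nat.one_le_pow _ _ Fintype.card_pos
  have hNQ : N ≤ Q ^ 4 := (Nat.le_mul_of_pos_right N hp.pos).trans hb₂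
  have hsupp : ∀ i v, v.1 ∉ occurring (A i) → α v i = 0 := by
    intro i v hv
    apply hα₀
    have : A i v.1 = 0 := by simpa [occurring] using hv
    simp [this]
  have hcard : ∀ i ∈ S, (occurring (A i)).card * (k * Nat.clog 2 p) ≤ N := fun i hi =>
    Nat.mul_le_mul_right _ (hW i hi)
  have hleaf : ∀ i ∈ S, ∀ d : ℤ, (d : ZMod p) ≠ ψ i (b i) → Derivable
      (insert ⟨-fun v => α v i, -d⟩ (insert ⟨fun v => α v i, d⟩ F.system)) ((M * Q) ^ 7)
      ⟨0, 1⟩ := by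
    intro i hi d hd
    refine (refute_equation β (A i) (b i) (ψ i) (fun v => α v i) (fun v => hα v i) (hsupp i) F
      (equationClauses_subset β A b i) (fun j hj => rangeClauses_subset β A b i hj) d hd
      (hcard i hi)).mono subset_rfl ?_
    -- The exponent `7` leaves one spare factor `M * Q` above `Q ^ 6`; with `M ≥ 2` it absorbs the
    -- constants.
    calc 2 ^ N * (N * 2 + 7) ≤ Q ^ 2 * (Q ^ 4 * 2 + 7 * Q ^ 4) := by
          gcongr
          exact Nat.le_mul_of_pos_right 7 (by positivity)
      _ = 9 * Q ^ 6 := by ring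
      _ ≤ 2 ^ 7 * Q ^ 7 :=
          Nat.mul_le_mul (by norm_num) (Nat.pow_le_pow_right hQ1 (by norm_num))
      _ = (2 * Q) ^ 7 := (mul_pow _ _ _).symm
      _ ≤ (M * Q) ^ 7 := by gcongr
  have hbound : ∀ T ⊆ S, ∃ lo : ℤ, ∃ r ≤ M * (N * p),
      Derivable F.system (2 + M * (2 + N * 2 + 1)) ⟨∑ i ∈ T, fun v => α v i, lo⟩ ∧
      Derivable F.system (2 + M * (2 + N * 2 + 1)) ⟨-∑ i ∈ T, fun v => α v i, -(lo + r)⟩ := by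
    intro T hT
    have hi : ∀ i ∈ T, ∃ lo : ℤ, ∃ r ≤ N * p, Derivable F.system (2 + N * 2)
        ⟨fun v => α v i, lo⟩ ∧ Derivable F.system (2 + N * 2) ⟨-fun v => α v i, -(lo + r)⟩ := by
      intro i hi
      have hBN : (occurring (A i) ×ˢ (Finset.univ : Finset (Fin k × Fin (Nat.clog 2 p)))).card ≤
          N := by
        simpa [Finset.card_product] using hcard i (hT hi)
      obtain ⟨lo, h₁, h₂⟩ := range_of_support hsys F.hasBounds
        (occurring (A i) ×ˢ Finset.univ) (fun v => α v i)
        fun v hv => hsupp i v (by simpa using hv)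
      refine ⟨lo, _, ?_, h₁.mono subset_rfl (by omega), h₂.mono subset_rfl (by omega)⟩
      refine (Finset.sum_le_card_nsmul _ _ p fun v _ => hαp v i).trans ?_
      exact Nat.mul_le_mul_right _ hBN
    choose! lo r hr h₁ h₂ using hi
    have hTM : T.card ≤ M := Finset.card_le_card hT
    refine ⟨∑ i ∈ T, lo i, ∑ i ∈ T, r i, ?_, ?_, ?_⟩
    · exact (Finset.sum_le_card_nsmul _ _ _ hr).trans (Nat.mul_le_mul_right _ hTM)
    · convert (sum hsys T _ lo (fun _ => 1) h₁).mono subset_rfl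
        (Nat.add_le_add_left (Nat.mul_le_mul_right _ hTM) 2) using 2
      · funext v
        simp
      · simp
    · convert (sum hsys T _ _ (fun _ => 1) h₂).mono subset_rfl
        (Nat.add_le_add_left (Nat.mul_le_mul_right _ hTM) 2) using 2
      · funext v
        simp
      · simp [Finset.sum_add_distrib]
  have hMQ : 2 ≤ M * Q := hS2.trans (Nat.le_mul_of_pos_right M hQ1)
  have hX : 2 * (2 + M * (2 + N * 2 + 1)) + 1 + 16 * (M * (N * p) + 1) ≤ (M * Q) ^ 7 := by
    have hQ4 : 1 ≤ Q ^ 4 := Nat.one_le_pow _ _ hQ1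
    calc 2 * (2 + M * (2 + N * 2 + 1)) + 1 + 16 * (M * (N * p) + 1)
        = 21 + M * (6 + 4 * N + 16 * (N * p)) := by ring
      _ ≤ 21 * (M * Q ^ 4) + M * (6 * Q ^ 4 + 4 * Q ^ 4 + 16 * Q ^ 4) := by
          gcongr
          · exact Nat.le_mul_of_pos_right 21 (by positivity)
          · exact Nat.le_mul_of_pos_right 6 hQ4
      _ = 47 * (M * Q ^ 4) := by ring
      _ ≤ M ^ 6 * (M * Q ^ 7) := by
          have : 2 ^ 6 ≤ M ^ 6 := Nat.pow_le_pow_left hS2 6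
          gcongr
          · omega
          · norm_num
      _ = (M * Q) ^ 7 := by ring
  -- The total form vanishes identically, so its value is `0`, but the forced residue is the
  -- non-zero coordinate `κ₀` of `∑ c i * b i`.
  have hmain := refute_sum (p := p) S (fun i v => α v i) (fun i => ψ i (b i)) hbound hleaf hX
    (Nat.clog 2 M) S subset_rfl (Finset.card_pos.1 (by omega)) (Nat.le_pow_clog one_lt_two M) 0 (by
      simp only [hψ, ← map_sum]
      simpa using hκ₀.symm)
  have hzero : (∑ i ∈ S, fun v => α v i) = fun _ => 0 := by
    funext v
    simpa using hαS v
  have hneg : (-fun _ : BitVar p k n => (0 : ℤ)) = fun _ => 0 := by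
    funext v
    simp
  -- Both inequalities fixing the total are now `0 ≥ 0`, derivable in two lines; one more factor `X`
  -- pays for them.
  rw [hzero, hneg, neg_zero, Set.insert_idem] at hmain
  refine ((Derivable.zero hsys).cut hmain).mono subset_rfl ?_
  have h2X : 2 ≤ (M * Q) ^ 7 := hMQ.trans (Nat.le_self_pow (by norm_num) _)
  rw [pow_mul]
  set X := (M * Q) ^ 7
  have h2 : 2 ≤ X ^ (Nat.clog 2 M + 1) := h2X.trans (Nat.le_self_pow (by omega) _)
  have h3 : X ^ (Nat.clog 2 M + 2) = X ^ (Nat.clog 2 M + 1) * X := by ring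
  rw [h3]
  nlinarith

/-- The numerical form of the size bound. -/
theorem pow_clog_le_rpow_logb {M m Y : ℕ} {Z : ℝ} (hM : 2 ≤ M) (hMm : M ≤ m) (hZ : 1 ≤ Z)
    (hY : (Y : ℝ) ≤ Z ^ 3) :
    ((Y ^ (7 * (Nat.clog 2 M + 2)) : ℕ) : ℝ) ≤ Z ^ (84 * Real.logb 2 m) := by
  have hM0 : (0 : ℝ) < M := by exact_mod_cast (by omega : 0 < M)
  have hlog : (Nat.clog 2 M : ℝ) ≤ Real.logb 2 M + 1 := by
    obtain ⟨r, hr⟩ : ∃ r, Nat.clog 2 M = r + 1 :=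
      ⟨_, (Nat.succ_pred (Nat.clog_pos one_lt_two (by omega)).ne').symm⟩
    have h := Nat.pow_pred_clog_lt_self one_lt_two (x := M) (by omega)
    rw [hr] at h ⊢
    have : (r : ℝ) ≤ Real.logb 2 M := by
      rw [Real.le_logb_iff_rpow_le one_lt_two hM0, Real.rpow_natCast]
      exact_mod_cast h.le
    push_cast
    linarith
  have hlog1 : 1 ≤ Real.logb 2 M := by
    rw [Real.le_logb_iff_rpow_le one_lt_two hM0, Real.rpow_one]
    exact_mod_cast hM
  have hlogm : Real.logb 2 M ≤ Real.logb 2 m :=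
    Real.logb_le_logb_of_le one_lt_two hM0 (by exact_mod_cast hMm)
  calc ((Y ^ (7 * (Nat.clog 2 M + 2)) : ℕ) : ℝ)
      = (Y : ℝ) ^ (7 * (Nat.clog 2 M + 2)) := by push_cast; rfl
    _ ≤ (Z ^ 3) ^ (7 * (Nat.clog 2 M + 2)) := by gcongr
    _ = Z ^ ((3 * (7 * (Nat.clog 2 M + 2)) : ℕ) : ℝ) := by rw [Real.rpow_natCast, ← pow_mul]
    -- The exponent is at most `21 * (log₂ M + 3) ≤ 84 * log₂ M`, as `log₂ M ≥ 1`.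
    _ ≤ Z ^ (84 * Real.logb 2 m) := by
        apply Real.rpow_le_rpow_of_exponent_le hZ
        push_cast
        linarith

end Refutation

theorem theorem3 :
    ∃ C : ℝ, ∀ (K : Type*) [Field K] [Fintype K] [DecidableEq K] (p : ℕ) [Fact p.Prime]
      [Algebra (ZMod p) K] (k : ℕ) (β : Module.Basis (Fin k) (ZMod p) K)
      (m n : ℕ) (A : Matrix (Fin m) (Fin n) K) (b : Fin m → K),
      (¬ ∃ z : Fin n → K, ∀ i, ∑ j, A i j * z j = b i) →
      ∃ (s : ℕ) (π : Fin s → LinIneq (BitVar p k n)),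
        IsCPRefutation (linearSystemCNF β A b).system π ∧
        (s : ℝ) ≤ ((linearSystemCNF β A b).card : ℝ) ^ (C * Real.logb 2 m) ∧
        ∀ d : ℕ, 2 ≤ d → (∀ i, (occurring (A i)).card ≤ d) →
          (s : ℝ) ≤ ((m : ℝ) * (Fintype.card K : ℝ) ^ (d - 1)) ^ (C * Real.logb 2 m) := by
  refine ⟨84, fun K _ _ _ p _ _ k β m n A b hunsat => ?_⟩
  classical
  set F := linearSystemCNF β A b with hF
  have hq : 1 ≤ Fintype.card K := Fintype.card_pos
  have hm : 1 ≤ m := by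
    by_contra h
    exact hunsat ⟨0, fun i => absurd i.2 (by omega)⟩
  have hbase : ∀ d : ℕ, (1 : ℝ) ≤ (m : ℝ) * (Fintype.card K : ℝ) ^ (d - 1) := fun d => by
    exact_mod_cast Nat.mul_le_mul hm (Nat.one_le_pow _ _ hq)
  obtain ⟨S, hS, hmin⟩ : ∃ S : Finset (Fin m),
      (¬ ∃ z : Fin n → K, ∀ i ∈ S, ∑ j, A i j * z j = b i) ∧
      ∀ i ∈ S, ∃ z : Fin n → K, ∀ i' ∈ S.erase i, ∑ j, A i' j * z j = b i' := by
    obtain ⟨S, hS⟩ := exists_minimal_of_wellFoundedLT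
      (fun S : Finset (Fin m) => ¬ ∃ z : Fin n → K, ∀ i ∈ S, ∑ j, A i j * z j = b i)
      ⟨Finset.univ, by simpa using hunsat⟩
    refine ⟨S, hS.prop, fun i hi => ?_⟩
    by_contra h
    exact Finset.notMem_erase i S (hS.le_of_le h (Finset.erase_subset i S) hi)
  have hown : ∀ i ∈ S, ∃ z : Fin n → K, ∑ j, A i j * z j ≠ b i ∧
      ∀ i' ∈ S, i' ≠ i → ∑ j, A i' j * z j = b i' := by
    intro i hi
    obtain ⟨z, hz⟩ := hmin i hi
    refine ⟨z, fun h => hS ⟨z, fun i' hi' => ?_⟩, fun i' hi' hne =>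
      hz i' (Finset.mem_erase.2 ⟨hne, hi'⟩)⟩
    by_cases hne : i' = i
    · rw [hne, h]
    · exact hz i' (Finset.mem_erase.2 ⟨hne, hi'⟩)
  have hMF : S.card ≤ F.card := card_le_card_linearSystemCNF β A b S hown
  have hSm : S.card ≤ m := by simpa using Finset.card_le_univ S
  have hSpos : 0 < S.card := by
    rw [Finset.card_pos]
    by_contra h
    rw [Finset.not_nonempty_iff_eq_empty] at h
    exact hS ⟨0, by simp [h]⟩
  have hF1 : 1 ≤ F.card := hSpos.trans_le hMF
  -- For `m = 1` the bound is one line, so a single contradictory equation is treated apart: it has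
  -- no variables, and its clause is empty, which is already `0 ≥ 1`.
  rcases (show S.card = 1 ∨ 2 ≤ S.card by omega) with h1 | h2
  · obtain ⟨i, rfl⟩ := Finset.card_eq_one.1 h1
    have hzero : occurring (A i) = ∅ := by
      rw [Finset.eq_empty_iff_forall_notMem]
      intro j hj
      have hj' : A i j ≠ 0 := by simpa [occurring] using hj
      refine hS ⟨Pi.single j (b i / A i j), ?_⟩
      simp [Pi.single_apply, mul_div_cancel₀ _ hj']
    obtain ⟨z, hz, -⟩ := hown i (by simp)
    have hempty : (∅ : Clause (BitVar p k n)) ∈ F := by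
      apply equationClauses_subset β A b i
      simp only [equationClauses, Finset.mem_image, Finset.mem_filter, Finset.mem_univ, true_and]
      exact ⟨z, hz, by simp [ruleOut, hzero]⟩
    have hexp : 0 ≤ 84 * Real.logb 2 m :=
      mul_nonneg (by norm_num) (Real.logb_nonneg one_lt_two (by exact_mod_cast hm))
    refine ⟨1, fun _ => ⟨fun _ => 0, 1⟩, ⟨fun _ => Or.inl (Or.inr (Or.inr ⟨∅, hempty, ?_⟩)),
      0, rfl, rfl⟩, ?_, fun d _ _ => ?_⟩
    · simp [Clause.toIneq]
    · rw [Nat.cast_one]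
      exact Real.one_le_rpow (by exact_mod_cast hF1) hexp
    · rw [Nat.cast_one]
      exact Real.one_le_rpow (hbase d) hexp
  · set W := S.sup fun i => (occurring (A i)).card with hW
    have hder := Derivable.refute_system β A b S h2 hS
      (fun i hi => Finset.le_sup (f := fun i => (occurring (A i)).card) hi)
      (Finset.card_pos.1 hF1)
    obtain ⟨s, hs, π, hπ⟩ := hder.exists_refutation
    have hs' : (s : ℝ) ≤ (((S.card * Fintype.card K ^ W) ^ (7 * (Nat.clog 2 S.card + 2)) : ℕ) : ℝ) :=
      by exact_mod_cast hs
    refine ⟨s, π, hπ, ?_, fun d hd hwd => ?_⟩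
    · refine hs'.trans (pow_clog_le_rpow_logb h2 hSm (by exact_mod_cast hF1) ?_)
      obtain ⟨i, hi, hiW⟩ := Finset.exists_mem_eq_sup S (Finset.card_pos.1 hSpos)
        fun i => (occurring (A i)).card
      -- The clauses of a widest equation of `S` alone suffice. Below, `2 ≤ |F|` turns the bound
      -- into `|F| ^ 2`.
      have hQ : Fintype.card K ^ W ≤ 2 * F.card := by
        rw [hW, hiW]
        rcases (occurring (A i)).eq_empty_or_nonempty with h | h
        · simp [h]
          omega
        · exact (card_pow_le_two_mul_card_equationClauses β (A i) (b i) h).trans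
            (Nat.mul_le_mul_left 2 (Finset.card_le_card (equationClauses_subset β A b i)))
      have : S.card * Fintype.card K ^ W ≤ F.card ^ 3 := by
        calc S.card * Fintype.card K ^ W ≤ F.card * (F.card * F.card) :=
              Nat.mul_le_mul hMF (hQ.trans (Nat.mul_le_mul_right _ (h2.trans hMF)))
          _ = F.card ^ 3 := by ring
      exact_mod_cast this
    · refine hs'.trans (pow_clog_le_rpow_logb h2 hSm (hbase d) ?_)
      have hWd : W ≤ d := Finset.sup_le fun i _ => hwd i
      -- This is where `d ≥ 2` enters: `W ≤ d ≤ 3 * (d - 1)`.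
      have : S.card * Fintype.card K ^ W ≤ (m * Fintype.card K ^ (d - 1)) ^ 3 := by
        calc S.card * Fintype.card K ^ W ≤ m ^ 3 * Fintype.card K ^ ((d - 1) * 3) :=
              Nat.mul_le_mul (hSm.trans (Nat.le_self_pow (by norm_num) m))
                (Nat.pow_le_pow_right hq (by omega))
          _ = (m * Fintype.card K ^ (d - 1)) ^ 3 := by rw [mul_pow, pow_mul]
      exact_mod_cast this
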